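/- Let $A$ be a finite set. Let $\Delta(A)$ be the simplex whose vertices are the two-element subsets of $A$; a face of $\Delta(A)$ is the same as a (nonempty) set of edges of a graph with vertex set $A$. Let $M(A)\subset\Delta(A)$ be the subcomplex of all faces whose graph is not connected (as a graph on all of $A$), and let $K(A)=\Delta(A)/M(A)$ be the quotient complex (the complex of connected graphs). Let $\nabla(A)$ be the simplex whose vertices are the unordered partitions of $A$ into two nonempty subsets, let $\Omega(A)\subset\nabla(A)$ be the subcomplex of all faces for which there are two distinct elements $a,b\in A$ lying in the same part of every partition that is a vertex of the face, and let $C(A)=\nabla(A)/\Omega(A)$ be the quotient complex (the complex of complete partitions). The homology of a quotient complex $X/Y$ with coefficients in an abelian group $G$ is the homology of the quotient of the simplicial chain complex of $X$ by that of $Y$, i.e. $H_*(X,Y;G)$. Theorem 3. For every finite set $A$, every abelian group $G$ and every $i\ge 0$ there is an isomorphism $$H_i(C(A),G)\;\cong\;H_i(K(A),G),$$ natural in $A$ with respect to bijections $A\to B$ of finite sets and in $G$ with respect to homomorphisms of abelian groups. -/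

import Mathlib

open CategoryTheory

universe u v w

namespace Vassiliev

/-! ### Oriented simplicial chains -/

section Chains

variable {V : Type u} {W : Type w} {G G' : Type v} [AddCommGroup G] [AddCommGroup G']

/-- The finite set of the entries of a tuple of vertices. -/
noncomputable def vertexSet {n : ℕ} (x : Fin n → V) : Finset V :=
  (Set.finite_range x).toFinset

/-- Oriented simplicial `n`-chains of the simplicial complex `X`, with coefficients in `G`,
for a finite vertex set `V`. A chain is recorded by its coefficients: `c (x₀, …, xₙ)` is the
coefficient at the oriented simplex `[x₀, …, xₙ]`. It changes by the sign of the permutation when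
the vertices are permuted, and it is zero unless `x₀, …, xₙ` are the distinct vertices of a face
of `X`. -/
def orientedChains (X : PreAbstractSimplicialComplex V) (G : Type v) [AddCommGroup G] (n : ℕ) :
    AddSubgroup ((Fin (n + 1) → V) → G) where
  carrier := {c | (∀ (x : Fin (n + 1) → V) (σ : Equiv.Perm (Fin (n + 1))),
                      c (x ∘ σ) = Equiv.Perm.sign σ • c x) ∧
                  (∀ x : Fin (n + 1) → V, ¬ Function.Injective x → c x = 0) ∧
                  (∀ x : Fin (n + 1) → V, vertexSet x ∉ X.faces → c x = 0)}
  zero_mem' := by simp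
  add_mem' := by
    rintro a b ⟨ha, ha', ha''⟩ ⟨hb, hb', hb''⟩
    refine ⟨fun x σ => ?_, fun x hx => ?_, fun x hx => ?_⟩
    · simp [ha x σ, hb x σ]
    · simp [ha' x hx, hb' x hx]
    · simp [ha'' x hx, hb'' x hx]
  neg_mem' := by
    rintro a ⟨ha, ha', ha''⟩
    refine ⟨fun x σ => ?_, fun x hx => ?_, fun x hx => ?_⟩
    · simp [ha x σ]
    · simp [ha' x hx]
    · simp [ha'' x hx]

/-- The simplicial boundary `∂[x₀, …, xₙ₊₁] = ∑ i, (-1)^i [x₀, …, x̂ᵢ, …, xₙ₊₁]` in terms of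
coefficients: the coefficient of `∂ c` at `[x₀, …, xₙ]` is the sum over all vertices `v` of the
coefficients of `c` at `[v, x₀, …, xₙ]`. -/
noncomputable def boundary [Finite V] (G : Type v) [AddCommGroup G] (n : ℕ) :
    ((Fin (n + 2) → V) → G) →+ ((Fin (n + 1) → V) → G) where
  toFun c x := ∑ᶠ v : V, c (Fin.cons v x)
  map_zero' := by ext x; simp
  map_add' a b := by
    ext x
    exact finsum_add_distrib (Set.toFinite _) (Set.toFinite _)

theorem boundary_mem [Finite V] (X : PreAbstractSimplicialComplex V) {n : ℕ}
    {c : (Fin (n + 2) → V) → G} (hc : c ∈ orientedChains X G (n + 1)) :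
    boundary G n c ∈ orientedChains X G n := by
  obtain ⟨h₁, h₂, h₃⟩ := hc
  refine ⟨fun x σ => ?_, fun x hx => ?_, fun x hx => ?_⟩
  · have key : ∀ v : V, c (Fin.cons v (x ∘ σ)) = Equiv.Perm.sign σ • c (Fin.cons v x) := by
      intro v
      have h := h₁ (Fin.cons v x) (Equiv.Perm.decomposeFin.symm (0, σ))
      rw [Equiv.Perm.decomposeFin.symm_sign] at h
      simp only [if_true, one_mul] at h
      rw [← h]
      congr 1
      funext i
      refine Fin.cases ?_ (fun j => ?_) i
      · simp
      · simp
    have : Fintype V := Fintype.ofFinite V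
    simp only [boundary, AddMonoidHom.coe_mk, ZeroHom.coe_mk, finsum_eq_sum_of_fintype, key,
      Finset.smul_sum]
  · refine finsum_eq_zero_of_forall_eq_zero fun v => h₂ _ fun h => hx ?_
    have := h.comp (Fin.succ_injective _)
    simpa [Function.comp_def] using this
  · refine finsum_eq_zero_of_forall_eq_zero fun v => h₃ _ fun h => hx ?_
    refine (X.isRelLowerSet_faces h).2 ?_ ?_
    · intro y hy
      simp only [vertexSet, Set.Finite.mem_toFinset, Set.mem_range] at hy ⊢
      obtain ⟨i, rfl⟩ := hy
      exact ⟨i.succ, by simp⟩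
    · exact ⟨x 0, by simp [vertexSet]⟩

theorem boundary_boundary [Finite V] (X : PreAbstractSimplicialComplex V) {n : ℕ}
    {c : (Fin (n + 3) → V) → G} (hc : c ∈ orientedChains X G (n + 2)) :
    boundary G n (boundary G (n + 1) c) = 0 := by
  obtain ⟨h₁, h₂, -⟩ := hc
  have : Fintype V := Fintype.ofFinite V
  ext x
  simp only [boundary, AddMonoidHom.coe_mk, ZeroHom.coe_mk, finsum_eq_sum_of_fintype,
    Pi.zero_apply]
  rw [← Finset.sum_product']
  refine Finset.sum_involution (fun p _ => (p.2, p.1)) ?_ ?_ (by simp) (by simp)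
  · rintro ⟨a, b⟩ -
    have h := h₁ (Fin.cons b (Fin.cons a x)) (Equiv.swap 0 1)
    have e : (Fin.cons b (Fin.cons a x) : Fin (n + 3) → V) ∘ (Equiv.swap 0 1) =
        Fin.cons a (Fin.cons b x) := by
      funext i
      refine Fin.cases ?_ (fun j => ?_) i
      · simp
      · refine Fin.cases ?_ (fun k => ?_) j
        · simp
        · have : Equiv.swap (0 : Fin (n + 3)) 1 k.succ.succ = k.succ.succ :=
            Equiv.swap_apply_of_ne_of_ne (Fin.succ_ne_zero _)
              (fun h => Fin.succ_ne_zero k (Fin.succ_injective _ h))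
          simp [this]
    rw [e, Equiv.Perm.sign_swap (by simp)] at h
    simp [h]
  · rintro ⟨a, b⟩ - hne heq
    have hab : b = a := congrArg Prod.fst heq
    apply hne
    apply h₂
    intro hinj
    have : (0 : Fin (n + 3)) = 1 := hinj (by
      change b = a
      exact hab)
    simp at this

/-- Relative `n`-chains of the pair `(X, Y)`, i.e. `n`-chains of the quotient complex `X / Y`. -/
abbrev relChains (X Y : PreAbstractSimplicialComplex V) (G : Type v) [AddCommGroup G] (n : ℕ) :
    Type (max u v) :=
  orientedChains X G n ⧸ (orientedChains Y G n).addSubgroupOf (orientedChains X G n)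

/-- The boundary of chains of `X`. -/
noncomputable def chainBoundary [Finite V] (X : PreAbstractSimplicialComplex V) (G : Type v)
    [AddCommGroup G] (n : ℕ) : orientedChains X G (n + 1) →+ orientedChains X G n :=
  ((boundary G n).comp (orientedChains X G (n + 1)).subtype).codRestrict _
    fun c => boundary_mem X c.2

/-- The boundary of chains of the quotient complex `X / Y`. -/
noncomputable def relBoundary [Finite V] (X Y : PreAbstractSimplicialComplex V) (G : Type v)
    [AddCommGroup G] (n : ℕ) : relChains X Y G (n + 1) →+ relChains X Y G n :=
  QuotientAddGroup.map _ _ (chainBoundary X G n) fun _ hc => boundary_mem Y hc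

/-- The chain complex of the quotient complex `X / Y` with coefficients in `G`: in degree `n`
it is the quotient of the group of `n`-chains of `X` by the group of `n`-chains of the subcomplex
`Y`. -/
noncomputable def relChainComplex [Finite V] (X Y : PreAbstractSimplicialComplex V) (G : Type v)
    [AddCommGroup G] : ChainComplex AddCommGrpCat.{max u v} ℕ :=
  ChainComplex.of (fun n => AddCommGrpCat.of (relChains X Y G n))
    (fun n => AddCommGrpCat.ofHom (relBoundary X Y G n)) (by
      intro n
      rw [← AddCommGrpCat.ofHom_comp]
      refine AddCommGrpCat.hom_ext (AddMonoidHom.ext fun c => ?_)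
      obtain ⟨c, rfl⟩ := QuotientAddGroup.mk_surjective c
      change ((chainBoundary X G n (chainBoundary X G (n + 1) c) : orientedChains X G n) :
        relChains X Y G n) = 0
      have : chainBoundary X G n (chainBoundary X G (n + 1) c) = 0 :=
        Subtype.ext (boundary_boundary X c.2)
      rw [this]
      rfl)

theorem relChainComplex_d [Finite V] (X Y : PreAbstractSimplicialComplex V) (G : Type v)
    [AddCommGroup G] (n : ℕ) : (relChainComplex X Y G).d (n + 1) n =
      AddCommGrpCat.ofHom (relBoundary X Y G n) :=
  ChainComplex.of_d (fun n => AddCommGrpCat.of (relChains X Y G n))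
    (fun n => AddCommGrpCat.ofHom (relBoundary X Y G n)) n

/-- A bijection `ε` of the vertex sets carries the simplices of `X` to simplices of `X'`. -/
def MapsFaces (ε : V ≃ W) (X : PreAbstractSimplicialComplex V)
    (X' : PreAbstractSimplicialComplex W) : Prop :=
  ∀ s ∈ X.faces, s.map ε.toEmbedding ∈ X'.faces

/-- The map of coefficient functions that is induced by a bijection of the vertices and a
homomorphism of the coefficient groups. -/
def push (ε : V ≃ W) (f : G →+ G') (n : ℕ) :
    ((Fin n → V) → G) →+ ((Fin n → W) → G') where
  toFun c x := f (c (ε.symm ∘ x))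
  map_zero' := by ext; simp
  map_add' a b := by ext; simp

theorem push_mem (ε : V ≃ W) (f : G →+ G') {X : PreAbstractSimplicialComplex V}
    {X' : PreAbstractSimplicialComplex W} (h : MapsFaces ε X X') {n : ℕ}
    {c : (Fin (n + 1) → V) → G} (hc : c ∈ orientedChains X G n) :
    push ε f (n + 1) c ∈ orientedChains X' G' n := by
  obtain ⟨h₁, h₂, h₃⟩ := hc
  refine ⟨fun x σ => ?_, fun x hx => ?_, fun x hx => ?_⟩
  · have := h₁ (ε.symm ∘ x) σ
    simp only [push, AddMonoidHom.coe_mk, ZeroHom.coe_mk, ← Function.comp_assoc, this]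
    rcases Int.units_eq_one_or (Equiv.Perm.sign σ) with h | h <;> simp [h]
  · have : c (ε.symm ∘ x) = 0 := h₂ _ fun hi => hx (by
      have := ε.injective.comp hi
      simpa [← Function.comp_assoc] using this)
    simp [push, this]
  · have : c (ε.symm ∘ x) = 0 := h₃ _ fun hi => hx (by
      convert h _ hi
      ext y
      simp only [vertexSet, Set.Finite.mem_toFinset, Set.mem_range, Finset.mem_map,
        Function.comp_apply, Equiv.coe_toEmbedding]
      constructor
      · rintro ⟨i, rfl⟩
        exact ⟨_, ⟨i, rfl⟩, by simp⟩
      · rintro ⟨_, ⟨i, rfl⟩, rfl⟩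
        exact ⟨i, by simp⟩)
    simp [push, this]

theorem boundary_push [Finite V] [Finite W] (ε : V ≃ W) (f : G →+ G') (n : ℕ)
    (c : (Fin (n + 2) → V) → G) :
    boundary G' n (push ε f (n + 2) c) = push ε f (n + 1) (boundary G n c) := by
  have : Fintype V := Fintype.ofFinite V
  have : Fintype W := Fintype.ofFinite W
  ext x
  simp only [boundary, push, AddMonoidHom.coe_mk, ZeroHom.coe_mk, finsum_eq_sum_of_fintype,
    map_sum]
  refine (Fintype.sum_equiv ε _ _ fun v => ?_).symm
  congr 2
  funext i
  refine Fin.cases ?_ (fun j => ?_) i <;> simp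

/-- The map of chains of `X` induced by `ε` and `f`. -/
def chainPush (ε : V ≃ W) (f : G →+ G') {X : PreAbstractSimplicialComplex V}
    {X' : PreAbstractSimplicialComplex W} (h : MapsFaces ε X X') (n : ℕ) :
    orientedChains X G n →+ orientedChains X' G' n :=
  ((push ε f (n + 1)).comp (orientedChains X G n).subtype).codRestrict _
    fun c => push_mem ε f h c.2

/-- The map of chains of quotient complexes induced by `ε` and `f`. -/
def relPush (ε : V ≃ W) (f : G →+ G') {X Y : PreAbstractSimplicialComplex V}
    {X' Y' : PreAbstractSimplicialComplex W} (hX : MapsFaces ε X X') (hY : MapsFaces ε Y Y')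
    (n : ℕ) : relChains X Y G n →+ relChains X' Y' G' n :=
  QuotientAddGroup.map _ _ (chainPush ε f hX n) fun _ hc => push_mem ε f hY hc

end Chains

section ChainMaps

variable {V V' V'' : Type u} {G G' G'' : Type v} [AddCommGroup G] [AddCommGroup G']
  [AddCommGroup G''] [Finite V] [Finite V'] [Finite V'']
  {X Y : PreAbstractSimplicialComplex V} {X' Y' : PreAbstractSimplicialComplex V'}
  {X'' Y'' : PreAbstractSimplicialComplex V''}

/-- The chain map of quotient complexes induced by a bijection of the vertices and a homomorphism
of the coefficient groups. -/
noncomputable def relMap (ε : V ≃ V') (f : G →+ G') (hX : MapsFaces ε X X')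
    (hY : MapsFaces ε Y Y') : relChainComplex X Y G ⟶ relChainComplex X' Y' G' :=
  ChainComplex.ofHom (fun n => AddCommGrpCat.ofHom (relPush ε f hX hY n)) (by
    intro n
    rw [relChainComplex_d, relChainComplex_d]
    refine AddCommGrpCat.hom_ext (AddMonoidHom.ext fun c => ?_)
    obtain ⟨c, rfl⟩ := QuotientAddGroup.mk_surjective c
    change ((chainBoundary X' G' n (chainPush ε f hX (n + 1) c) : orientedChains X' G' n) :
        relChains X' Y' G' n) =
      ((chainPush ε f hX n (chainBoundary X G n c) : orientedChains X' G' n) :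
        relChains X' Y' G' n)
    congr 1
    exact Subtype.ext (boundary_push ε f n c))

theorem relMap_eq_id (ε : V ≃ V) (f : G →+ G) (hX : MapsFaces ε X X) (hY : MapsFaces ε Y Y)
    (hε : ∀ a, ε a = a) (hf : ∀ g, f g = g) : relMap ε f hX hY = 𝟙 _ := by
  obtain rfl : ε = Equiv.refl V := Equiv.ext hε
  obtain rfl : f = AddMonoidHom.id G := AddMonoidHom.ext hf
  refine HomologicalComplex.hom_ext _ _ fun n => AddCommGrpCat.hom_ext (AddMonoidHom.ext fun c => ?_)
  obtain ⟨c, rfl⟩ := QuotientAddGroup.mk_surjective c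
  rfl

theorem relMap_comp (ε : V ≃ V') (ε' : V' ≃ V'') (ε'' : V ≃ V'') (f : G →+ G') (f' : G' →+ G'')
    (f'' : G →+ G'') (hX : MapsFaces ε X X') (hY : MapsFaces ε Y Y')
    (hX' : MapsFaces ε' X' X'') (hY' : MapsFaces ε' Y' Y'')
    (hX'' : MapsFaces ε'' X X'') (hY'' : MapsFaces ε'' Y Y'')
    (hε : ∀ a, ε'' a = ε' (ε a)) (hf : ∀ g, f'' g = f' (f g)) :
    relMap ε'' f'' hX'' hY'' = relMap ε f hX hY ≫ relMap ε' f' hX' hY' := by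
  obtain rfl : ε'' = ε.trans ε' := Equiv.ext hε
  obtain rfl : f'' = f'.comp f := AddMonoidHom.ext hf
  refine HomologicalComplex.hom_ext _ _ fun n => AddCommGrpCat.hom_ext (AddMonoidHom.ext fun c => ?_)
  obtain ⟨c, rfl⟩ := QuotientAddGroup.mk_surjective c
  rfl

end ChainMaps

/-! ### The complex of connected graphs -/

section Graphs

variable {A B : Type u}

/-- The two-element subsets of `A`: the vertices of the simplex `Δ(A)`. -/
abbrev TwoSubset (A : Type u) : Type u := {e : Sym2 A // ¬ e.IsDiag}

/-- The graph on the vertex set `A` depicted by a set of two-element subsets. -/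
def faceGraph (s : Finset (TwoSubset A)) : SimpleGraph A :=
  SimpleGraph.fromEdgeSet (Subtype.val '' (s : Set (TwoSubset A)))

/-- The complex `Δ(A)`: the simplex spanned by all two-element subsets of `A`. -/
def graphSimplex (A : Type u) : PreAbstractSimplicialComplex (TwoSubset A) := ⊤

/-- The subcomplex `M(A)` of `Δ(A)`: the faces whose graph is not connected, i.e. has two vertices
that are not joined by a chain of edges. -/
def nonconnectedGraphs (A : Type u) : PreAbstractSimplicialComplex (TwoSubset A) where
  faces := {s | s.Nonempty ∧ ¬ (faceGraph s).Preconnected}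
  isRelLowerSet_faces := fun _ hs => ⟨hs.1, fun _ hts ht => ⟨ht, fun hc => hs.2 (hc.mono
    (SimpleGraph.fromEdgeSet_mono (Set.image_mono (Finset.coe_subset.mpr hts))))⟩⟩

/-- The bijection of two-element subsets induced by a bijection `A ≃ B`. -/
def twoSubsetCongr (e : A ≃ B) : TwoSubset A ≃ TwoSubset B where
  toFun x := ⟨Sym2.map e x.1, by
    obtain ⟨x, hx⟩ := x
    induction x with | _ a b => simpa using hx⟩
  invFun x := ⟨Sym2.map e.symm x.1, by
    obtain ⟨x, hx⟩ := x
    induction x with | _ a b => simpa using hx⟩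
  left_inv x := by
    obtain ⟨x, hx⟩ := x
    induction x with | _ a b => simp
  right_inv x := by
    obtain ⟨x, hx⟩ := x
    induction x with | _ a b => simp

theorem mapsFaces_graphSimplex (e : A ≃ B) :
    MapsFaces (twoSubsetCongr e) (graphSimplex A) (graphSimplex B) := by
  intro s hs
  exact Finset.Nonempty.map (f := (twoSubsetCongr e).toEmbedding) (s := s) hs

theorem mapsFaces_nonconnectedGraphs (e : A ≃ B) :
    MapsFaces (twoSubsetCongr e) (nonconnectedGraphs A) (nonconnectedGraphs B) := by
  rintro s ⟨hs, hc⟩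
  refine ⟨hs.map, fun h => hc ?_⟩
  let φ : faceGraph (s.map (twoSubsetCongr e).toEmbedding) →g faceGraph s :=
    { toFun := e.symm
      map_rel' := by
        rintro a b ⟨hab, hne⟩
        refine ⟨?_, fun h => hne (e.symm.injective h)⟩
        obtain ⟨x, hx, hxab⟩ := hab
        obtain ⟨y, hy, rfl⟩ := Finset.mem_map.mp (Finset.mem_coe.mp hx)
        refine ⟨y, hy, ?_⟩
        have : y = (twoSubsetCongr e).symm ⟨s(a, b), hxab ▸ (twoSubsetCongr e y).2⟩ := by
          rw [Equiv.eq_symm_apply]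
          exact Subtype.ext hxab
        rw [this]
        rfl }
  intro a b
  have := (h (e a) (e b)).map φ
  simpa [φ] using this

/-- The chain complex of the complex of connected graphs `K(A) = Δ(A) / M(A)`, as a functor of the
finite set `A` (with respect to bijections) and of the coefficient group `G`. -/
noncomputable def connectedGraphComplex :
    Core FintypeCat.{u} × AddCommGrpCat.{v} ⥤ ChainComplex AddCommGrpCat.{max u v} ℕ where
  obj P := relChainComplex (graphSimplex P.1.of) (nonconnectedGraphs P.1.of) P.2
  map f := relMap (twoSubsetCongr (FintypeCat.equivEquivIso.symm f.1.iso)) f.2.hom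
    (mapsFaces_graphSimplex _) (mapsFaces_nonconnectedGraphs _)
  map_id _ := by
    refine relMap_eq_id _ _ _ _ (fun x => ?_) (fun _ => rfl)
    obtain ⟨x, hx⟩ := x
    induction x with | _ a b => rfl
  map_comp _ _ := by
    refine relMap_comp _ _ _ _ _ _ _ _ _ _ _ _ (fun x => ?_) (fun _ => rfl)
    obtain ⟨x, hx⟩ := x
    induction x with | _ a b => rfl

end Graphs

/-! ### The complex of complete partitions -/

section Partitions

variable {A B : Type u}

/-- The unordered partitions of `A` into two nonempty subsets, given as equivalence relations with
exactly two classes: the vertices of the simplex `∇(A)`. -/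
abbrev TwoPartition (A : Type u) : Type u := {r : Setoid A // Nat.card (Quotient r) = 2}

instance [Finite A] : Finite (TwoPartition A) :=
  Finite.of_injective (fun r : TwoPartition A => (fun a b => r.1 a b : A → A → Prop))
    fun _ _ h => Subtype.ext (Setoid.ext fun a b => iff_of_eq (congrFun (congrFun h a) b))

/-- The complex `∇(A)`: the simplex spanned by all partitions of `A` into two nonempty subsets. -/
def partitionSimplex (A : Type u) : PreAbstractSimplicialComplex (TwoPartition A) := ⊤

/-- The subcomplex `Ω(A)` of `∇(A)`: the non-complete faces, i.e. those for which some two elements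
of `A` lie in the same part of every partition that is a vertex of the face. -/
def noncompletePartitions (A : Type u) : PreAbstractSimplicialComplex (TwoPartition A) where
  faces := {s | s.Nonempty ∧ ∃ a b : A, a ≠ b ∧ ∀ r ∈ s, r.1 a b}
  isRelLowerSet_faces := fun _ hs => ⟨hs.1, fun _ hts ht => ⟨ht, by
    obtain ⟨a, b, hab, h⟩ := hs.2
    exact ⟨a, b, hab, fun r hr => h r (hts hr)⟩⟩⟩

theorem card_quotient_comap (e : A ≃ B) (r : Setoid B) :
    Nat.card (Quotient (r.comap e)) = Nat.card (Quotient r) :=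
  Nat.card_congr (Quotient.congr e fun _ _ => Iff.rfl)

/-- The bijection of partitions into two parts induced by a bijection `A ≃ B`. -/
def twoPartitionCongr (e : A ≃ B) : TwoPartition A ≃ TwoPartition B where
  toFun r := ⟨r.1.comap e.symm, (card_quotient_comap e.symm r.1).trans r.2⟩
  invFun r := ⟨r.1.comap e, (card_quotient_comap e r.1).trans r.2⟩
  left_inv r := Subtype.ext (Setoid.ext fun a b => by simp [Setoid.comap_rel])
  right_inv r := Subtype.ext (Setoid.ext fun a b => by simp [Setoid.comap_rel])

theorem mapsFaces_partitionSimplex (e : A ≃ B) :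
    MapsFaces (twoPartitionCongr e) (partitionSimplex A) (partitionSimplex B) := by
  intro s hs
  exact Finset.Nonempty.map (f := (twoPartitionCongr e).toEmbedding) (s := s) hs

theorem mapsFaces_noncompletePartitions (e : A ≃ B) :
    MapsFaces (twoPartitionCongr e) (noncompletePartitions A) (noncompletePartitions B) := by
  rintro s ⟨hs, a, b, hab, h⟩
  refine ⟨hs.map, e a, e b, fun h => hab (e.injective h), fun r hr => ?_⟩
  obtain ⟨r', hr', rfl⟩ := Finset.mem_map.mp hr
  change r'.1 (e.symm (e a)) (e.symm (e b))
  simpa using h r' hr'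

/-- The chain complex of the complex of complete partitions `C(A) = ∇(A) / Ω(A)`, as a functor of
the finite set `A` (with respect to bijections) and of the coefficient group `G`. -/
noncomputable def completePartitionComplex :
    Core FintypeCat.{u} × AddCommGrpCat.{v} ⥤ ChainComplex AddCommGrpCat.{max u v} ℕ where
  obj P := relChainComplex (partitionSimplex P.1.of) (noncompletePartitions P.1.of) P.2
  map f := relMap (twoPartitionCongr (FintypeCat.equivEquivIso.symm f.1.iso)) f.2.hom
    (mapsFaces_partitionSimplex _) (mapsFaces_noncompletePartitions _)
  map_id _ := relMap_eq_id _ _ _ _ (fun _ => rfl) (fun _ => rfl)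
  map_comp _ _ := relMap_comp _ _ _ _ _ _ _ _ _ _ _ _ (fun _ => rfl) (fun _ => rfl)

end Partitions

end Vassiliev

/-! The theorem is a relative form of Dowker duality. Relate an edge to a two-part partition when
its ends lie in the same part (`LiesInPart`). A nonempty set of edges is non-connected exactly when
all its edges are related to one partition, and a nonempty set of partitions is non-complete exactly
when all its partitions are related to one edge. So `nonconnectedGraphs` and `noncompletePartitions`
are the two Dowker complexes of one relation.

Both pairs embed into a third one: the full simplex on edges and partitions together, modulo
`dowkerJoin LiesInPart`. Each inclusion is a quasi-isomorphism (`quasiIso_embeddingMap`). For the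
inclusion of the edges, what has to be contracted is spanned by the simplices that contain a
partition and are not faces of `dowkerJoin`. To each such simplex join an edge that depends only on
its partitions and is related to all of them if such an edge exists (`exists_isConeSelection_inl`).
Deleting this edge from a simplex outside `dowkerJoin` never produces a face, and the cone is a
contraction up to an error controlled by the number of partitions (`boundary_cone`); induction on
that number finishes the argument. The other inclusion is symmetric.

The choices occur only in the proofs that the inclusions are quasi-isomorphisms. The inclusions
themselves are canonical, so the resulting zigzag is natural in the set and in the coefficients. -/

namespace Vassiliev

/-! ### Tuples of vertices and removal of an entry. -/

section VertexSets

variable {U : Type u}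

theorem mem_vertexSet {n : ℕ} {x : Fin n → U} {u : U} : u ∈ vertexSet x ↔ ∃ i, x i = u := by
  simp [vertexSet]

theorem vertexSet_comp_perm {n : ℕ} (x : Fin n → U) (σ : Equiv.Perm (Fin n)) :
    vertexSet (x ∘ σ) = vertexSet x := by
  ext u
  simp only [mem_vertexSet, Function.comp_apply]
  exact ⟨fun ⟨i, h⟩ => ⟨_, h⟩, fun ⟨i, h⟩ => ⟨σ.symm i, by simpa using h⟩⟩

open Classical in
theorem vertexSet_cons {n : ℕ} (u : U) (x : Fin n → U) :
    vertexSet (Fin.cons u x : Fin (n + 1) → U) = insert u (vertexSet x) := by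
  ext a
  simp [mem_vertexSet, Fin.exists_fin_succ, eq_comm]

/-- The tuple `x` with its `j`-th entry removed and its initial entry moved to the vacant place. -/
def removeEntry {n : ℕ} (x : Fin (n + 1) → U) (j : Fin (n + 1)) : Fin n → U :=
  Fin.tail (x ∘ Equiv.swap 0 j)

theorem cons_removeEntry {n : ℕ} (x : Fin (n + 1) → U) (j : Fin (n + 1)) :
    (Fin.cons (x j) (removeEntry x j) : Fin (n + 1) → U) = x ∘ Equiv.swap 0 j := by
  have h := Fin.cons_self_tail (x ∘ Equiv.swap 0 j)
  simpa [removeEntry] using h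

open Classical in
theorem vertexSet_eq_insert_removeEntry {n : ℕ} (x : Fin (n + 1) → U) (j : Fin (n + 1)) :
    vertexSet x = insert (x j) (vertexSet (removeEntry x j)) := by
  rw [← vertexSet_cons, cons_removeEntry, vertexSet_comp_perm]

theorem cons_removeEntry_comp_swap {n : ℕ} (x : Fin (n + 1) → U) (j : Fin (n + 1)) (u : U) :
    (Fin.cons u (removeEntry x j) : Fin (n + 1) → U) ∘ Equiv.swap 0 j = Function.update x j u := by
  funext i
  rcases eq_or_ne i j with rfl | hij
  · simp
  · rw [Function.update_of_ne hij, Function.comp_apply]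
    have hne : Equiv.swap 0 j i ≠ 0 := by
      intro h
      apply hij
      rw [Equiv.swap_apply_eq_iff] at h
      simpa using h
    obtain ⟨k, hk⟩ := Fin.exists_succ_eq_of_ne_zero hne
    rw [← hk, Fin.cons_succ, removeEntry, Fin.tail, hk]
    simp

theorem removeEntry_cons_zero {n : ℕ} (u : U) (x : Fin n → U) :
    removeEntry (Fin.cons u x : Fin (n + 1) → U) 0 = x := by
  funext i
  simp [removeEntry, Fin.tail]

theorem removeEntry_cons_succ {n : ℕ} (u : U) (x : Fin n → U) (j : Fin n) :
    removeEntry (Fin.cons u x : Fin (n + 1) → U) j.succ = Function.update x j u := by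
  funext i
  rcases eq_or_ne i j with rfl | hij
  · simp [removeEntry, Fin.tail]
  · have : Equiv.swap (0 : Fin (n + 1)) j.succ i.succ = i.succ :=
      Equiv.swap_apply_of_ne_of_ne (Fin.succ_ne_zero _) fun h => hij (Fin.succ_injective _ h)
    simp [removeEntry, Fin.tail, hij, this]

/-- Removing an entry of a permuted tuple amounts, up to a permutation, to removing an entry of
the original one. -/
theorem exists_removeEntry_comp_perm {n : ℕ} (x : Fin (n + 1) → U) (σ : Equiv.Perm (Fin (n + 1)))
    (i : Fin (n + 1)) : ∃ τ : Equiv.Perm (Fin n),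
      removeEntry (x ∘ σ) i = removeEntry x (σ i) ∘ τ ∧
        Equiv.Perm.sign (Equiv.swap 0 i) * Equiv.Perm.sign τ =
          Equiv.Perm.sign σ * Equiv.Perm.sign (Equiv.swap 0 (σ i)) := by
  -- Conjugating by the two swaps moves the removed entry to place 0 on both sides; the result fixes
  -- 0, so it comes from a permutation of the tail with the same sign.
  set ρ : Equiv.Perm (Fin (n + 1)) := Equiv.swap 0 (σ i) * σ * Equiv.swap 0 i with hρ
  have hρ0 : ρ 0 = 0 := by simp [hρ]
  obtain ⟨⟨p, τ⟩, hτ⟩ := Equiv.Perm.decomposeFin.symm.surjective ρ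
  have hp : p = 0 := by
    have h := Equiv.Perm.decomposeFin_symm_apply_zero p τ
    rw [hτ, hρ0] at h
    exact h.symm
  subst hp
  have hsucc : ∀ k, ρ k.succ = (τ k).succ := fun k => by
    rw [← hτ, Equiv.Perm.decomposeFin_symm_apply_succ]
    simp
  refine ⟨τ, ?_, ?_⟩
  · funext k
    simp only [removeEntry, Fin.tail, Function.comp_apply, ← hsucc]
    simp [hρ]
  · have h := Equiv.Perm.decomposeFin.symm_sign 0 τ
    rw [hτ, hρ, if_pos rfl, one_mul, map_mul, map_mul] at h
    rw [← h]
    rcases Int.units_eq_one_or (Equiv.Perm.sign (Equiv.swap 0 i)) with h | h <;>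
      simp [h, mul_comm]

end VertexSets

/-! ### The cone operator on coefficient functions. -/

section ConeOperator

variable {U : Type u} {G : Type v} [AddCommGroup G]

open Classical in
/-- One summand of the cone operator: if the `i`-th entry of `x` is the vertex selected for `x`,
the coefficient at the tuple without this entry. -/
noncomputable def coneTerm (sel : Finset U → U) {n : ℕ} (c : (Fin n → U) → G)
    (x : Fin (n + 1) → U) (i : Fin (n + 1)) : G :=
  if x i = sel (vertexSet x) then Equiv.Perm.sign (Equiv.swap 0 i) • c (removeEntry x i) else 0

/-- The cone operator, which joins the simplex with vertex set `z` to the vertex `sel z`. -/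
noncomputable def cone (sel : Finset U → U) {n : ℕ} (c : (Fin n → U) → G)
    (x : Fin (n + 1) → U) : G :=
  ∑ i, coneTerm sel c x i

theorem coneTerm_comp_perm (sel : Finset U → U) {n : ℕ} {c : (Fin n → U) → G}
    (hc : ∀ (x : Fin n → U) (σ : Equiv.Perm (Fin n)), c (x ∘ σ) = Equiv.Perm.sign σ • c x)
    (x : Fin (n + 1) → U) (σ : Equiv.Perm (Fin (n + 1))) (i : Fin (n + 1)) :
    coneTerm sel c (x ∘ σ) i = Equiv.Perm.sign σ • coneTerm sel c x (σ i) := by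
  obtain ⟨τ, h₁, h₂⟩ := exists_removeEntry_comp_perm x σ i
  rw [coneTerm, coneTerm, smul_ite, smul_zero]
  rw [h₁, hc, smul_smul, smul_smul, h₂]
  classical
  exact if_congr (by rw [vertexSet_comp_perm]; rfl) rfl rfl

/-- The target is the full simplex because joining the selected vertex may leave `X`. -/
theorem cone_mem (sel : Finset U → U) {X : PreAbstractSimplicialComplex U} {n : ℕ}
    {c : (Fin (n + 1) → U) → G} (hc : c ∈ orientedChains X G n) :
    cone sel c ∈ orientedChains ⊤ G (n + 1) := by
  obtain ⟨h₁, h₂, -⟩ := hc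
  refine ⟨fun x σ => ?_, fun x hx => ?_, fun x hx => ?_⟩
  · simp only [cone, coneTerm_comp_perm sel h₁, Finset.smul_sum]
    exact Equiv.sum_comp σ fun i => Equiv.Perm.sign σ • coneTerm sel c x i
  · simp only [Function.Injective, not_forall] at hx
    obtain ⟨a, b, hab, hne⟩ := hx
    -- For equal entries at `a` and `b`, the terms at these places cancel by the transposition;
    -- every other term still contains the repetition and vanishes.
    rw [cone, Fintype.sum_eq_add a b hne]
    · have hswap : x ∘ Equiv.swap a b = x := by
        funext k
        simp only [Function.comp_apply, Equiv.swap_apply_def]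
        split_ifs with h h' <;> simp_all
      have h := coneTerm_comp_perm sel h₁ x (Equiv.swap a b) a
      rw [hswap, Equiv.Perm.sign_swap hne, Equiv.swap_apply_left] at h
      simp [h]
    · rintro i ⟨hia, hib⟩
      rw [coneTerm, h₂, smul_zero, ite_self]
      intro hinj
      have key : ∀ k, k ≠ i → ∃ l : Fin (n + 1), Equiv.swap 0 i l.succ = k := fun k hk => by
        have : Equiv.swap 0 i k ≠ 0 := by
          rw [Ne, Equiv.swap_apply_eq_iff]
          simpa using hk
        obtain ⟨l, hl⟩ := Fin.exists_succ_eq_of_ne_zero this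
        exact ⟨l, by rw [hl]; simp⟩
      obtain ⟨l, hl⟩ := key a hia.symm
      obtain ⟨l', hl'⟩ := key b hib.symm
      have : l = l' := hinj (by simp [removeEntry, Fin.tail, hl, hl', hab])
      exact hne (by rw [← hl, ← hl', this])
  · exact absurd ⟨x 0, mem_vertexSet.mpr ⟨0, rfl⟩⟩ hx

-- Prepares the homotopy formula: summed over `u`, the first term gives back `c x`, and the second
-- becomes a coefficient of the boundary of `c`. Each later place contributes the sign of a
-- transposition, hence the uniform minus.
open Classical in
theorem cone_cons (sel : Finset U → U) {n : ℕ} (c : (Fin n → U) → G) (u : U) (x : Fin n → U) :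
    cone sel c (Fin.cons u x) =
      (if u = sel (insert u (vertexSet x)) then c x else 0) -
        ∑ j, if x j = sel (insert u (vertexSet x)) then c (Function.update x j u) else 0 := by
  rw [cone, Fin.sum_univ_succ, sub_eq_add_neg, ← Finset.sum_neg_distrib]
  congr 1
  · rw [coneTerm]
    refine if_congr (by rw [vertexSet_cons]; rfl) ?_ rfl
    simp [removeEntry_cons_zero]
  · refine Finset.sum_congr rfl fun j _ => ?_
    rw [coneTerm, apply_ite (fun g : G => -g), neg_zero]
    refine if_congr (by rw [vertexSet_cons]; rfl) ?_ rfl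
    rw [Equiv.Perm.sign_swap (Fin.succ_ne_zero j).symm, removeEntry_cons_succ]
    simp

end ConeOperator

/-! ### Quasi-isomorphisms in terms of representing cycles. -/

section QuasiIsoCriterion

theorem quasiIso_of_elements {S₁ S₂ : ShortComplex AddCommGrpCat.{u}} (φ : S₁ ⟶ S₂)
    (inj : ∀ (x : S₁.X₂) (y : S₂.X₁), S₁.g x = 0 → S₂.f y = φ.τ₂ x → ∃ y', S₁.f y' = x)
    (surj : ∀ x : S₂.X₂, S₂.g x = 0 → ∃ z : S₁.X₂, S₁.g z = 0 ∧ ∃ y, S₂.f y = x - φ.τ₂ z) :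
    ShortComplex.QuasiIso φ := by
  have γ : ShortComplex.LeftHomologyMapData φ S₁.abLeftHomologyData S₂.abLeftHomologyData :=
    default
  rw [γ.quasiIso_iff]
  have hK : ∀ x, (γ.φK x).1 = φ.τ₂ x.1 := fun x => ConcreteCategory.congr_hom γ.commi x
  obtain ⟨k, hK, hH⟩ : ∃ k : S₁.g.hom.ker → S₂.g.hom.ker, (∀ x, (k x).1 = φ.τ₂ x.1) ∧
      ∀ x : S₁.g.hom.ker, γ.φH (x : S₁.g.hom.ker ⧸ S₁.abToCycles.range) =
        (k x : S₂.g.hom.ker ⧸ S₂.abToCycles.range) :=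
    ⟨fun x => γ.φK x, hK,
      fun x => ConcreteCategory.congr_hom γ.commπ x⟩
  have : Mono γ.φH := by
    rw [AddCommGrpCat.mono_iff_injective, injective_iff_map_eq_zero]
    intro a ha
    obtain ⟨x, rfl⟩ := QuotientAddGroup.mk_surjective a
    obtain ⟨y, hy⟩ := (QuotientAddGroup.eq_zero_iff _).mp ((hH x).symm.trans ha)
    obtain ⟨y', hy'⟩ := inj x.1 y x.2 ((congrArg Subtype.val hy).trans (hK x))
    exact (QuotientAddGroup.eq_zero_iff x).mpr ⟨y', Subtype.ext hy'⟩
  have : Epi γ.φH := by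
    rw [AddCommGrpCat.epi_iff_surjective]
    intro a
    obtain ⟨x, rfl⟩ := QuotientAddGroup.mk_surjective a
    obtain ⟨z, hz, y, hy⟩ := surj x.1 x.2
    refine ⟨QuotientAddGroup.mk ⟨z, hz⟩, (hH ⟨z, hz⟩).trans ?_⟩
    refine (QuotientAddGroup.eq (s := S₂.abToCycles.range)).mpr ⟨y, Subtype.ext (hy.trans ?_)⟩
    rw [AddSubgroup.coe_add, AddSubgroup.coe_neg, neg_add_eq_sub, hK]
  exact isIso_of_mono_of_epi _

end QuasiIsoCriterion

/-! ### Contracting the simplices outside `P` and `Y`. -/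

section Deformation

variable {U : Type u} {G : Type v} [AddCommGroup G]

open Classical in
/-- `sel` selects a vertex in `P` for each set of vertices that is not contained in `P`, in such a
way that faces of `Y` remain faces when the selected vertex is added. The choice depends only on
the vertices outside `P`. -/
structure IsConeSelection (P : Set U) (Y : PreAbstractSimplicialComplex U)
    (sel : Finset U → U) : Prop where
  sel_mem : ∀ z : Finset U, ¬ (z : Set U) ⊆ P → sel z ∈ P
  insert_mem : ∀ z : Finset U, ¬ (z : Set U) ⊆ P → z ∈ Y.faces → insert (sel z) z ∈ Y.faces
  sel_insert : ∀ u ∈ P, ∀ z : Finset U, ¬ (z : Set U) ⊆ P → sel (insert u z) = sel z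

variable {P : Set U} {X Y : PreAbstractSimplicialComplex U} {sel : Finset U → U}

theorem IsConeSelection.of_decidableEq [inst : DecidableEq U]
    (h₁ : ∀ z : Finset U, ¬ (z : Set U) ⊆ P → sel z ∈ P)
    (h₂ : ∀ z : Finset U, ¬ (z : Set U) ⊆ P → z ∈ Y.faces → insert (sel z) z ∈ Y.faces)
    (h₃ : ∀ u ∈ P, ∀ z : Finset U, ¬ (z : Set U) ⊆ P → sel (insert u z) = sel z) :
    IsConeSelection P Y sel := by
  obtain rfl : inst = fun _ _ => Classical.propDecidable _ := Subsingleton.elim _ _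
  exact ⟨h₁, h₂, h₃⟩

/-- The selected vertex lies in `P`, so deleting it does not change the selection; if the smaller
simplex were a face of `Y`, putting the vertex back would make `x` one too. -/
theorem IsConeSelection.removeEntry (h : IsConeSelection P Y sel) {n : ℕ} {x : Fin (n + 1) → U}
    (hP : ¬ (vertexSet x : Set U) ⊆ P) (hY : vertexSet x ∉ Y.faces) {j : Fin (n + 1)}
    (hj : x j = sel (vertexSet x)) :
    ¬ (vertexSet (removeEntry x j) : Set U) ⊆ P ∧ vertexSet (removeEntry x j) ∉ Y.faces := by
  classical
  have hs := vertexSet_eq_insert_removeEntry x j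
  have hjP : x j ∈ P := hj ▸ h.sel_mem _ hP
  have hP' : ¬ (vertexSet (Vassiliev.removeEntry x j) : Set U) ⊆ P := fun h' => hP (by
    rw [hs, Finset.coe_insert]
    exact Set.insert_subset hjP h')
  refine ⟨hP', fun h' => hY ?_⟩
  have := h.insert_mem _ hP' h'
  rwa [← h.sel_insert _ hjP _ hP', ← hs, ← hj, ← hs] at this

theorem face_of_subset {s t : Finset U} (ht : t ∈ Y.faces) (hst : s ⊆ t) (hs : s.Nonempty) :
    s ∈ Y.faces :=
  (Y.isRelLowerSet_faces ht).2 hst hs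

theorem nonempty_of_not_subset {z : Finset U} (hz : ¬ (z : Set U) ⊆ P) : z.Nonempty := by
  rw [Finset.nonempty_iff_ne_empty]
  rintro rfl
  simp at hz

-- The usual identity ∂∘cone + cone∘∂ = id would hold if the selection never changed. It can change
-- only when a vertex outside `P` is added, and `hm` says that `c` vanishes on the simplices this
-- produces.
open Classical in
theorem boundary_cone [Finite U] (h : IsConeSelection P Y sel) {n : ℕ}
    {c : (Fin (n + 1) → U) → G} (hc : c ∈ orientedChains X G n)
    (hd : ∀ y : Fin n → U, ¬ (vertexSet y : Set U) ⊆ P → vertexSet y ∉ Y.faces →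
      ∑ᶠ u, c (Fin.cons u y) = 0)
    {x : Fin (n + 1) → U} (hP : ¬ (vertexSet x : Set U) ⊆ P) (hY : vertexSet x ∉ Y.faces)
    (hm : ∀ y : Fin (n + 1) → U, vertexSet y ∉ Y.faces →
      ((vertexSet x).filter (· ∉ P)).card < ((vertexSet y).filter (· ∉ P)).card → c y = 0) :
    boundary G n (cone sel c) x = c x := by
  have : Fintype U := Fintype.ofFinite U
  -- For `u` outside `P` both conditions fail, since selected vertices lie in `P`.
  have h₁ : ∀ u, (if u = sel (insert u (vertexSet x)) then c x else 0) =
      if u = sel (vertexSet x) then c x else 0 := fun u => by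
    by_cases hu : u ∈ P
    · rw [h.sel_insert u hu _ hP]
    · rw [if_neg, if_neg]
      · exact fun e => hu (e ▸ h.sel_mem _ hP)
      · refine fun e => hu (e ▸ h.sel_mem _ fun h' => hP ?_)
        exact (Finset.coe_subset.mpr (Finset.subset_insert _ _)).trans h'
  have hface : ∀ u, vertexSet (Fin.cons u x : Fin (n + 2) → U) ∉ Y.faces := fun u h' =>
    hY (face_of_subset h' (by rw [vertexSet_cons]; exact Finset.subset_insert _ _)
      (nonempty_of_not_subset hP))
  have hP' : ∀ u, ¬ (vertexSet (Fin.cons u x : Fin (n + 2) → U) : Set U) ⊆ P := fun u h' => hP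
    ((Finset.coe_subset.mpr (by rw [vertexSet_cons]; exact Finset.subset_insert _ _)).trans h')
  -- Exchanging an entry in `P` for a new vertex outside `P` raises the number counted in `hm`.
  have hcard : ∀ u ∉ vertexSet x, u ∉ P → ∀ j, x j ∈ P →
      vertexSet (Function.update x j u) ∉ Y.faces → c (Function.update x j u) = 0 := by
    intro u hux hu j hj hface'
    refine hm _ hface' (Finset.card_lt_card ?_)
    have hsub : insert u ((vertexSet x).filter (· ∉ P)) ⊆
        (vertexSet (Function.update x j u)).filter (· ∉ P) := by
      intro a ha
      rw [Finset.mem_insert, Finset.mem_filter, mem_vertexSet] at ha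
      rw [Finset.mem_filter, mem_vertexSet]
      rcases ha with rfl | ⟨⟨i, rfl⟩, ha⟩
      · exact ⟨⟨j, by simp⟩, hu⟩
      · refine ⟨⟨i, Function.update_of_ne (fun e : i = j => ha (by rw [e]; exact hj)) _ _⟩, ha⟩
    exact (Finset.ssubset_insert (by simp [hux])).trans_subset hsub
  have h₂ : ∀ u j, (if x j = sel (insert u (vertexSet x)) then c (Function.update x j u) else 0) =
      if x j = sel (vertexSet x) then c (Function.update x j u) else 0 := fun u j => by
    by_cases hu : u ∈ P
    · rw [h.sel_insert u hu _ hP]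
    by_cases hux : u ∈ vertexSet x
    · rw [Finset.insert_eq_of_mem hux]
    have e₁ : x j = sel (insert u (vertexSet x)) → c (Function.update x j u) = 0 := fun e => by
      rw [← vertexSet_cons] at e
      refine hcard u hux hu j (e ▸ h.sel_mem _ (hP' u)) ?_
      rw [← removeEntry_cons_succ]
      exact (h.removeEntry (hP' u) (hface u) (j := j.succ) e).2
    have e₂ : x j = sel (vertexSet x) → c (Function.update x j u) = 0 := fun e => by
      refine hcard u hux hu j (e ▸ h.sel_mem _ hP) fun h' => ?_
      obtain ⟨hP'', hY''⟩ := h.removeEntry hP hY e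
      refine hY'' (face_of_subset h' ?_ (nonempty_of_not_subset hP''))
      rw [← cons_removeEntry_comp_swap, vertexSet_comp_perm, vertexSet_cons]
      exact Finset.subset_insert _ _
    split_ifs with g₁ g₂ g₂
    · rfl
    · exact e₁ g₁
    · exact (e₂ g₂).symm
    · rfl
  -- Up to sign this is the boundary of `c` at `x` without its selected vertex, a simplex to which
  -- `hd` applies.
  have h₃ : ∀ j, ∑ u, (if x j = sel (vertexSet x) then c (Function.update x j u) else 0) = 0 := by
    intro j
    by_cases e : x j = sel (vertexSet x)
    · obtain ⟨hP'', hY''⟩ := h.removeEntry hP hY e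
      have := hd _ hP'' hY''
      rw [finsum_eq_sum_of_fintype] at this
      simp only [if_pos e, ← cons_removeEntry_comp_swap, hc.1, ← Finset.smul_sum, this, smul_zero]
    · simp [if_neg e]
  simp only [boundary, AddMonoidHom.coe_mk, ZeroHom.coe_mk, finsum_eq_sum_of_fintype, cone_cons,
    h₁, h₂, Finset.sum_sub_distrib]
  rw [Finset.sum_comm, Finset.sum_congr rfl fun j _ => h₃ j]
  simp

/-- A chain whose boundary vanishes on the simplices that are neither in `P` nor in `Y` agrees on
these simplices with a boundary. -/
theorem exists_eq_boundary_of_isConeSelection [Finite U] (h : IsConeSelection P Y sel) {n : ℕ}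
    {c : (Fin (n + 1) → U) → G} (hc : c ∈ orientedChains ⊤ G n)
    (hd : ∀ y : Fin n → U, ¬ (vertexSet y : Set U) ⊆ P → vertexSet y ∉ Y.faces →
      ∑ᶠ u, c (Fin.cons u y) = 0) :
    ∃ b ∈ orientedChains (⊤ : PreAbstractSimplicialComplex U) G (n + 1),
      ∀ x : Fin (n + 1) → U, ¬ (vertexSet x : Set U) ⊆ P → vertexSet x ∉ Y.faces →
        boundary G n b x = c x := by
  classical
  have : Fintype U := Fintype.ofFinite U
  -- Induction on a bound `m` for the number of vertices outside `P` in the simplices, not in `Y`,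
  -- where `c` is nonzero. Subtracting the boundary of the cone lowers the bound by one.
  suffices H : ∀ (m : ℕ) (c : (Fin (n + 1) → U) → G), c ∈ orientedChains ⊤ G n →
      (∀ y : Fin n → U, ¬ (vertexSet y : Set U) ⊆ P → vertexSet y ∉ Y.faces →
        ∑ᶠ u, c (Fin.cons u y) = 0) →
      (∀ y : Fin (n + 1) → U, vertexSet y ∉ Y.faces →
        m < ((vertexSet y).filter (· ∉ P)).card → c y = 0) →
      ∃ b ∈ orientedChains (⊤ : PreAbstractSimplicialComplex U) G (n + 1),
        ∀ x : Fin (n + 1) → U, ¬ (vertexSet x : Set U) ⊆ P → vertexSet x ∉ Y.faces →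
          boundary G n b x = c x from
    H (Fintype.card U) c hc hd fun y _ hy => absurd hy (not_lt.mpr (Finset.card_le_univ _))
  intro m
  induction m with
  | zero =>
    refine fun c _ _ hm => ⟨0, zero_mem _, fun x hP hY => ?_⟩
    rw [map_zero, hm x hY, Pi.zero_apply]
    obtain ⟨u, hu, huP⟩ := Set.not_subset.mp hP
    exact Finset.card_pos.mpr ⟨u, Finset.mem_filter.mpr ⟨hu, huP⟩⟩
  | succ m ih =>
    intro c hc hd hm
    have hb := cone_mem sel hc
    have hz : ∀ y : Fin n → U, ¬ (vertexSet y : Set U) ⊆ P →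
        ∑ᶠ u, boundary G n (cone sel c) (Fin.cons u y) = 0 := fun y hP => by
      cases n with
      -- In degree 0 there is no condition: the empty tuple lies in `P`.
      | zero => exact absurd (nonempty_of_not_subset hP) (by simp [vertexSet])
      | succ n => exact congrFun (boundary_boundary _ hb) y
    obtain ⟨b, hb', hbc⟩ : ∃ b ∈ orientedChains (⊤ : PreAbstractSimplicialComplex U) G (n + 1),
        ∀ x : Fin (n + 1) → U, ¬ (vertexSet x : Set U) ⊆ P → vertexSet x ∉ Y.faces →
          boundary G n b x = (c - boundary G n (cone sel c)) x := by
      refine ih _ (sub_mem hc (boundary_mem _ hb)) (fun y hP hY => ?_) (fun y hY hy => ?_)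
      · simp only [Pi.sub_apply]
        rw [finsum_sub_distrib (Set.toFinite _) (Set.toFinite _), hd y hP hY, hz y hP, sub_zero]
      · have hP : ¬ (vertexSet y : Set U) ⊆ P := by
          obtain ⟨u, hu⟩ := Finset.card_pos.mp (Nat.zero_lt_of_lt hy)
          exact fun hsub => (Finset.mem_filter.mp hu).2 (hsub (Finset.mem_filter.mp hu).1)
        rw [Pi.sub_apply, boundary_cone h hc hd hP hY
          fun z hz hlt => hm z hz (lt_of_le_of_lt hy hlt), sub_self]
    refine ⟨b + cone sel c, add_mem hb' hb, fun x hP hY => ?_⟩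
    rw [map_add, Pi.add_apply, hbc x hP hY, Pi.sub_apply, sub_add_cancel]

end Deformation

/-! ### Chains under an embedding of the vertex sets. -/

section Extension

variable {V : Type u} {U : Type w} {G : Type v} [AddCommGroup G]

theorem comp_embedding_injective (j : V ↪ U) (n : ℕ) :
    Function.Injective fun y : Fin n → V => j ∘ y :=
  j.injective.comp_left

/-- Extension by zero of coefficient functions along an embedding of the vertex sets. -/
noncomputable def extendChains (j : V ↪ U) (G : Type v) [AddCommGroup G] (n : ℕ) :
    ((Fin n → V) → G) →+ ((Fin n → U) → G) where
  toFun c := Function.extend (fun y => j ∘ y) c 0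
  map_zero' := Function.extend_zero _
  map_add' a b := by
    have h := Function.extend_add (fun y : Fin n → V => j ∘ y) a b 0 0
    rwa [add_zero] at h

theorem extendChains_comp (j : V ↪ U) {n : ℕ} (c : (Fin n → V) → G) (y : Fin n → V) :
    extendChains j G n c (j ∘ y) = c y :=
  (comp_embedding_injective j n).extend_apply c 0 y

theorem extendChains_of_forall_ne (j : V ↪ U) {n : ℕ} (c : (Fin n → V) → G) {x : Fin n → U}
    (hx : ∀ y : Fin n → V, j ∘ y ≠ x) : extendChains j G n c x = 0 :=
  Function.extend_apply' _ _ _ fun ⟨y, h⟩ => hx y h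

theorem vertexSet_comp_embedding (j : V ↪ U) {n : ℕ} (y : Fin n → V) :
    vertexSet (j ∘ y) = (vertexSet y).map j := by
  ext u
  simp [mem_vertexSet]

theorem vertexSet_subset_range_iff (j : V ↪ U) {n : ℕ} (x : Fin n → U) :
    (vertexSet x : Set U) ⊆ Set.range j ↔ ∃ y : Fin n → V, j ∘ y = x := by
  constructor
  · intro h
    have h' : ∀ i, ∃ v, j v = x i := fun i => h (mem_vertexSet.mpr ⟨i, rfl⟩)
    choose y hy using h'
    exact ⟨y, funext hy⟩
  · rintro ⟨y, rfl⟩ u hu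
    obtain ⟨i, rfl⟩ := mem_vertexSet.mp hu
    exact ⟨y i, rfl⟩

theorem extendChains_of_not_subset (j : V ↪ U) {n : ℕ} (c : (Fin n → V) → G) {x : Fin n → U}
    (hx : ¬ (vertexSet x : Set U) ⊆ Set.range j) : extendChains j G n c x = 0 :=
  extendChains_of_forall_ne j c fun y h => hx ((vertexSet_subset_range_iff j x).mpr ⟨y, h⟩)

theorem extendChains_mem (j : V ↪ U) {X : PreAbstractSimplicialComplex V}
    {X' : PreAbstractSimplicialComplex U} (h : ∀ s ∈ X.faces, s.map j ∈ X'.faces) {n : ℕ}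
    {c : (Fin (n + 1) → V) → G} (hc : c ∈ orientedChains X G n) :
    extendChains j G (n + 1) c ∈ orientedChains X' G n := by
  obtain ⟨h₁, h₂, h₃⟩ := hc
  refine ⟨fun x σ => ?_, fun x hx => ?_, fun x hx => ?_⟩ <;>
    by_cases hy : ∃ y : Fin (n + 1) → V, j ∘ y = x
  · obtain ⟨y, rfl⟩ := hy
    rw [Function.comp_assoc, extendChains_comp, extendChains_comp, h₁]
  · rw [extendChains_of_forall_ne j c (not_exists.mp hy), smul_zero,
      extendChains_of_forall_ne j c fun y h' => hy ⟨y ∘ σ.symm, ?_⟩]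
    rw [← Function.comp_assoc, h', Function.comp_assoc, Equiv.self_comp_symm, Function.comp_id]
  · obtain ⟨y, rfl⟩ := hy
    rw [extendChains_comp, h₂]
    exact fun hi => hx (j.injective.comp hi)
  · exact extendChains_of_forall_ne j c (not_exists.mp hy)
  · obtain ⟨y, rfl⟩ := hy
    rw [extendChains_comp, h₃]
    rw [vertexSet_comp_embedding] at hx
    exact fun hi => hx (h _ hi)
  · exact extendChains_of_forall_ne j c (not_exists.mp hy)

theorem boundary_extendChains [Finite V] [Finite U] (j : V ↪ U) (n : ℕ)
    (c : (Fin (n + 2) → V) → G) :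
    boundary G n (extendChains j G (n + 2) c) = extendChains j G (n + 1) (boundary G n c) := by
  have : Fintype V := Fintype.ofFinite V
  have : Fintype U := Fintype.ofFinite U
  ext x
  by_cases hx : ∃ y : Fin (n + 1) → V, j ∘ y = x
  · obtain ⟨y, rfl⟩ := hx
    simp only [extendChains_comp, boundary, AddMonoidHom.coe_mk, ZeroHom.coe_mk,
      finsum_eq_sum_of_fintype]
    refine (Fintype.sum_of_injective j j.injective _ _ (fun u hu => ?_) fun v => ?_).symm
    · refine extendChains_of_forall_ne j c fun z hz => hu ⟨z 0, ?_⟩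
      exact congrFun hz 0
    · rw [← extendChains_comp j c]
      refine congrArg _ (funext fun i => ?_)
      refine Fin.cases ?_ (fun k => ?_) i <;> simp
  · rw [extendChains_of_forall_ne j _ (not_exists.mp hx)]
    refine finsum_eq_zero_of_forall_eq_zero fun u => ?_
    refine extendChains_of_forall_ne j c fun z hz => hx ⟨Fin.tail z, ?_⟩
    funext i
    exact congrFun hz i.succ

/-- The map of chains induced by an embedding of the vertex sets. -/
noncomputable def chainExtend (j : V ↪ U) (G : Type v) [AddCommGroup G]
    {X : PreAbstractSimplicialComplex V} {X' : PreAbstractSimplicialComplex U}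
    (h : ∀ s ∈ X.faces, s.map j ∈ X'.faces) (n : ℕ) :
    orientedChains X G n →+ orientedChains X' G n :=
  ((extendChains j G (n + 1)).comp (orientedChains X G n).subtype).codRestrict _
    fun c => extendChains_mem j h c.2

/-- The map of chains of quotient complexes induced by an embedding of the vertex sets. -/
noncomputable def relExtend (j : V ↪ U) (G : Type v) [AddCommGroup G]
    {X Y : PreAbstractSimplicialComplex V} {X' Y' : PreAbstractSimplicialComplex U}
    (hX : ∀ s ∈ X.faces, s.map j ∈ X'.faces) (hY : ∀ s ∈ Y.faces, s.map j ∈ Y'.faces) (n : ℕ) :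
    relChains X Y G n →+ relChains X' Y' G n :=
  QuotientAddGroup.map _ _ (chainExtend j G hX n) fun _ hc => extendChains_mem j hY hc

end Extension

/-! ### Moving relative cycles and bounding chains into `V`. -/

section RelativeCycles

variable {V : Type u} {U : Type w} {G : Type v} [AddCommGroup G]
  {Y : PreAbstractSimplicialComplex V} {Y' : PreAbstractSimplicialComplex U} {j : V ↪ U}
  {sel : Finset U → U}

theorem mem_orientedChains_of_top {n : ℕ} {c : (Fin (n + 1) → U) → G} (hc : c ∈ orientedChains ⊤ G n)
    (h : ∀ x, vertexSet x ∉ Y'.faces → c x = 0) : c ∈ orientedChains Y' G n :=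
  ⟨hc.1, hc.2.1, h⟩

theorem mem_orientedChains_of_extendChains_mem (hY : ∀ s, s.map j ∈ Y'.faces → s ∈ Y.faces)
    {n : ℕ} {c : (Fin (n + 1) → V) → G} (hc : c ∈ orientedChains ⊤ G n)
    (h : extendChains j G (n + 1) c ∈ orientedChains Y' G n) : c ∈ orientedChains Y G n := by
  refine mem_orientedChains_of_top hc fun x hx => ?_
  rw [← extendChains_comp j c]
  refine h.2.2 _ fun h' => hx (hY _ ?_)
  rwa [← vertexSet_comp_embedding]

/-- A chain whose boundary is carried by `V` and `Y'` is homologous modulo `Y'` to a chain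
carried by `V`. -/
theorem exists_eq_boundary_add_extendChains [Finite U]
    (h : IsConeSelection (Set.range j) Y' sel) {n : ℕ}
    {c : (Fin (n + 1) → U) → G} (hc : c ∈ orientedChains ⊤ G n)
    (hd : ∀ y : Fin n → U, ¬ (vertexSet y : Set U) ⊆ Set.range j → vertexSet y ∉ Y'.faces →
      ∑ᶠ u, c (Fin.cons u y) = 0) :
    ∃ b ∈ orientedChains (⊤ : PreAbstractSimplicialComplex U) G (n + 1),
      ∃ y ∈ orientedChains (⊤ : PreAbstractSimplicialComplex V) G n,
        ∃ e ∈ orientedChains Y' G n, c = boundary G n b + extendChains j G (n + 1) y + e := by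
  obtain ⟨b, hb, hbc⟩ := exists_eq_boundary_of_isConeSelection h hc hd
  have hr := sub_mem hc (boundary_mem _ hb)
  set r := c - boundary G n b with hr_def
  -- The restriction of `r` to `V` is the required chain; `r` minus its extension vanishes on
  -- simplices in `V` by construction, and on those neither in `V` nor in `Y'` by the choice of `b`.
  have hy : (fun y : Fin (n + 1) → V => r (j ∘ y)) ∈ orientedChains ⊤ G n := by
    refine ⟨fun x σ => ?_, fun x hx => ?_, fun x hx => ?_⟩
    · exact hr.1 (j ∘ x) σ
    · exact hr.2.1 _ fun hi => hx (Function.Injective.of_comp hi)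
    · exact absurd ⟨x 0, mem_vertexSet.mpr ⟨0, rfl⟩⟩ hx
  refine ⟨b, hb, _, hy, r - extendChains j G (n + 1) (fun y => r (j ∘ y)), ?_, ?_⟩
  · refine mem_orientedChains_of_top (sub_mem hr (extendChains_mem j ?_ hy)) fun x hx => ?_
    · exact fun s hs => Finset.Nonempty.map (s := s) hs
    · by_cases hxj : (vertexSet x : Set U) ⊆ Set.range j
      · obtain ⟨y, rfl⟩ := (vertexSet_subset_range_iff j x).mp hxj
        rw [Pi.sub_apply, extendChains_comp, sub_self]
      · rw [Pi.sub_apply, extendChains_of_not_subset j _ hxj, hr_def, Pi.sub_apply, hbc x hxj hx,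
          sub_self, sub_self]
  · rw [hr_def]
    abel

variable [Finite U]
  {hX : ∀ s ∈ (⊤ : PreAbstractSimplicialComplex V).faces,
    s.map j ∈ (⊤ : PreAbstractSimplicialComplex U).faces}
  {hY : ∀ s ∈ Y.faces, s.map j ∈ Y'.faces}

theorem exists_relBoundary_eq_of_relExtend [Finite V] (h : IsConeSelection (Set.range j) Y' sel)
    (hY' : ∀ s, s.map j ∈ Y'.faces → s ∈ Y.faces) {n : ℕ} (x : relChains ⊤ Y G n)
    (y : relChains ⊤ Y' G (n + 1)) (hxy : relBoundary ⊤ Y' G n y = relExtend j G hX hY n x) :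
    ∃ y', relBoundary ⊤ Y G n y' = x := by
  obtain ⟨⟨x, hx⟩, rfl⟩ := QuotientAddGroup.mk_surjective x
  obtain ⟨⟨y, hy⟩, rfl⟩ := QuotientAddGroup.mk_surjective y
  change ((chainBoundary ⊤ G n ⟨y, hy⟩ : orientedChains ⊤ G n) : relChains ⊤ Y' G n) =
    (chainExtend j G hX n ⟨x, hx⟩ : orientedChains ⊤ G n) at hxy
  rw [QuotientAddGroup.eq] at hxy
  have hd : -boundary G n y + extendChains j G (n + 1) x ∈ orientedChains Y' G n := hxy
  -- The boundary of `y` agrees modulo `Y'` with a chain carried by `V`, so `y` can be replaced by a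
  -- chain `z` on `V`, which then bounds `x` modulo `Y`.
  obtain ⟨b, hb, z, hz, e, he, rfl⟩ := exists_eq_boundary_add_extendChains h hy
    (fun t ht ht' => by
      have := hd.2.2 t ht'
      rw [Pi.add_apply, extendChains_of_not_subset j _ ht, add_zero, Pi.neg_apply,
        neg_eq_zero] at this
      exact this)
  refine ⟨QuotientAddGroup.mk ⟨z, hz⟩, QuotientAddGroup.eq.mpr ?_⟩
  change -boundary G n z + x ∈ orientedChains Y G n
  refine mem_orientedChains_of_extendChains_mem hY' (add_mem (neg_mem (boundary_mem _ hz)) hx) ?_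
  rw [map_add, map_add, boundary_boundary _ hb, zero_add, boundary_extendChains] at hd
  have := add_mem hd (boundary_mem _ he)
  rw [map_add, map_neg]
  convert this using 1
  abel

theorem exists_relBoundary_eq_sub_relExtend_zero (h : IsConeSelection (Set.range j) Y' sel)
    (x : relChains ⊤ Y' G 0) :
    ∃ (z : relChains ⊤ Y G 0) (y : _), relBoundary ⊤ Y' G 0 y = x - relExtend j G hX hY 0 z := by
  obtain ⟨⟨x, hx⟩, rfl⟩ := QuotientAddGroup.mk_surjective x
  obtain ⟨b, hb, z, hz, e, he, rfl⟩ := exists_eq_boundary_add_extendChains h hx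
    (fun t ht _ => absurd (nonempty_of_not_subset ht) (by simp [vertexSet]))
  refine ⟨QuotientAddGroup.mk ⟨z, hz⟩, QuotientAddGroup.mk ⟨b, hb⟩, QuotientAddGroup.eq.mpr ?_⟩
  change -boundary G 0 b + (_ - extendChains j G 1 z) ∈ orientedChains Y' G 0
  convert he using 1
  simp only
  abel

theorem exists_relBoundary_eq_sub_relExtend_succ [Finite V]
    (h : IsConeSelection (Set.range j) Y' sel)
    (hY' : ∀ s, s.map j ∈ Y'.faces → s ∈ Y.faces) {n : ℕ} (x : relChains ⊤ Y' G (n + 1))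
    (hx : relBoundary ⊤ Y' G n x = 0) :
    ∃ z : relChains ⊤ Y G (n + 1), relBoundary ⊤ Y G n z = 0 ∧
      ∃ y, relBoundary ⊤ Y' G (n + 1) y = x - relExtend j G hX hY (n + 1) z := by
  obtain ⟨⟨x, hx'⟩, rfl⟩ := QuotientAddGroup.mk_surjective x
  have hd : boundary G n x ∈ orientedChains Y' G n :=
    (QuotientAddGroup.eq_zero_iff (chainBoundary ⊤ G n ⟨x, hx'⟩)).mp hx
  obtain ⟨b, hb, z, hz, e, he, rfl⟩ := exists_eq_boundary_add_extendChains h hx'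
    (fun t ht ht' => hd.2.2 t ht')
  refine ⟨QuotientAddGroup.mk ⟨z, hz⟩, (QuotientAddGroup.eq_zero_iff _).mpr ?_,
    QuotientAddGroup.mk ⟨b, hb⟩, QuotientAddGroup.eq.mpr ?_⟩
  · change boundary G n z ∈ orientedChains Y G n
    refine mem_orientedChains_of_extendChains_mem hY' (boundary_mem _ hz) ?_
    rw [map_add, map_add, boundary_boundary _ hb, zero_add, boundary_extendChains] at hd
    simpa using sub_mem hd (boundary_mem _ he)
  · change -boundary G (n + 1) b + (_ - extendChains j G (n + 2) z) ∈ orientedChains Y' G (n + 1)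
    convert he using 1
    simp only
    abel

end RelativeCycles

/-! ### The inclusion of pairs as a quasi-isomorphism. -/

section QuasiIsomorphism

variable {V U : Type u} [Finite V] [Finite U] (j : V ↪ U) (G : Type v) [AddCommGroup G]

/-- The chain map of quotient complexes induced by an embedding of the vertex sets. -/
noncomputable def embeddingMap {X Y : PreAbstractSimplicialComplex V}
    {X' Y' : PreAbstractSimplicialComplex U} (hX : ∀ s ∈ X.faces, s.map j ∈ X'.faces)
    (hY : ∀ s ∈ Y.faces, s.map j ∈ Y'.faces) : relChainComplex X Y G ⟶ relChainComplex X' Y' G :=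
  ChainComplex.ofHom (fun n => AddCommGrpCat.ofHom (relExtend j G hX hY n)) (by
    intro n
    rw [relChainComplex_d, relChainComplex_d]
    refine AddCommGrpCat.hom_ext (AddMonoidHom.ext fun c => ?_)
    obtain ⟨c, rfl⟩ := QuotientAddGroup.mk_surjective c
    change ((chainBoundary X' G n (chainExtend j G hX (n + 1) c) : orientedChains X' G n) :
        relChains X' Y' G n) =
      ((chainExtend j G hX n (chainBoundary X G n c) : orientedChains X' G n) :
        relChains X' Y' G n)
    congr 1
    exact Subtype.ext (boundary_extendChains j n c.1))

theorem quasiIso_embeddingMap {Y : PreAbstractSimplicialComplex V}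
    {Y' : PreAbstractSimplicialComplex U} {sel : Finset U → U}
    (h : IsConeSelection (Set.range j) Y' sel)
    (hX : ∀ s ∈ (⊤ : PreAbstractSimplicialComplex V).faces,
      s.map j ∈ (⊤ : PreAbstractSimplicialComplex U).faces)
    (hY : ∀ s ∈ Y.faces, s.map j ∈ Y'.faces) (hY' : ∀ s, s.map j ∈ Y'.faces → s ∈ Y.faces) :
    QuasiIso (embeddingMap j G hX hY) := by
  refine ⟨fun i => ?_⟩
  cases i with
  | zero =>
    rw [ChainComplex.quasiIsoAt₀_iff]
    refine quasiIso_of_elements _ (fun x y _ hxy => ?_) (fun x _ => ?_)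
    · change (relChainComplex ⊤ Y' G).d 1 0 y = relExtend j G hX hY 0 x at hxy
      change ∃ y', (relChainComplex ⊤ Y G).d 1 0 y' = x
      rw [relChainComplex_d] at hxy ⊢
      exact exists_relBoundary_eq_of_relExtend h hY' x y hxy
    · obtain ⟨z, y, hy⟩ := exists_relBoundary_eq_sub_relExtend_zero (hX := hX) (hY := hY) h x
      refine ⟨z, ?_, y, ?_⟩
      · change (relChainComplex ⊤ Y G).d 0 0 z = 0
        rw [(relChainComplex ⊤ Y G).shape 0 0 (by simp)]
        rfl
      · change (relChainComplex ⊤ Y' G).d 1 0 y =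
          (id x : relChains ⊤ Y' G 0) - relExtend j G hX hY 0 z
        rw [relChainComplex_d]
        exact hy
  | succ n =>
    rw [quasiIsoAt_iff' _ (n + 2) (n + 1) n (by simp) (by simp)]
    refine quasiIso_of_elements _ (fun x y _ hxy => ?_) (fun x hx => ?_)
    · change (relChainComplex ⊤ Y' G).d (n + 2) (n + 1) y = relExtend j G hX hY (n + 1) x at hxy
      change ∃ y', (relChainComplex ⊤ Y G).d (n + 2) (n + 1) y' = x
      rw [relChainComplex_d] at hxy ⊢
      exact exists_relBoundary_eq_of_relExtend h hY' x y hxy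
    · change (relChainComplex ⊤ Y' G).d (n + 1) n x = 0 at hx
      rw [relChainComplex_d] at hx
      obtain ⟨z, hz, y, hy⟩ :=
        exists_relBoundary_eq_sub_relExtend_succ (hX := hX) (hY := hY) h hY' x hx
      refine ⟨z, ?_, y, ?_⟩
      · change (relChainComplex ⊤ Y G).d (n + 1) n z = 0
        rw [relChainComplex_d]
        exact hz
      · change (relChainComplex ⊤ Y' G).d (n + 2) (n + 1) y =
          (id x : relChains ⊤ Y' G (n + 1)) - relExtend j G hX hY (n + 1) z
        rw [relChainComplex_d]
        exact hy

end QuasiIsomorphism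

/-! ### Compatibility with bijections and coefficient maps. -/

section Naturality

variable {V V' U U' : Type u} {G G' : Type v} [AddCommGroup G] [AddCommGroup G']

theorem extendChains_push (ε : V ≃ V') (δ : U ≃ U') (j : V ↪ U) (j' : V' ↪ U')
    (h : ∀ a, δ (j a) = j' (ε a)) (f : G →+ G') {n : ℕ} (c : (Fin n → V) → G) :
    extendChains j' G' n (push ε f n c) = push δ f n (extendChains j G n c) := by
  have h' : ∀ y : Fin n → V', δ.symm ∘ j' ∘ y = j ∘ ε.symm ∘ y := fun y => funext fun i => by
    simp [Equiv.symm_apply_eq, h]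
  funext x
  change _ = f (extendChains j G n c (δ.symm ∘ x))
  by_cases hx : ∃ y : Fin n → V', j' ∘ y = x
  · obtain ⟨y, rfl⟩ := hx
    rw [extendChains_comp, h', extendChains_comp]
    rfl
  · rw [extendChains_of_forall_ne j' _ (not_exists.mp hx), extendChains_of_forall_ne j, map_zero]
    refine fun y hy => hx ⟨ε ∘ y, funext fun i => ?_⟩
    have := congrFun hy i
    rw [Function.comp_apply, Function.comp_apply, Equiv.eq_symm_apply, h] at this
    exact this

theorem relMap_comp_embeddingMap [Finite V] [Finite V'] [Finite U] [Finite U']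
    {X₁ Y₁ : PreAbstractSimplicialComplex V} {X₁' Y₁' : PreAbstractSimplicialComplex V'}
    {X₂ Y₂ : PreAbstractSimplicialComplex U} {X₂' Y₂' : PreAbstractSimplicialComplex U'}
    (ε : V ≃ V') (δ : U ≃ U') (j : V ↪ U) (j' : V' ↪ U') (h : ∀ a, δ (j a) = j' (ε a))
    (f : G →+ G') (hX₁ : MapsFaces ε X₁ X₁') (hY₁ : MapsFaces ε Y₁ Y₁')
    (hX₂ : MapsFaces δ X₂ X₂') (hY₂ : MapsFaces δ Y₂ Y₂')
    (hX : ∀ s ∈ X₁.faces, s.map j ∈ X₂.faces) (hY : ∀ s ∈ Y₁.faces, s.map j ∈ Y₂.faces)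
    (hX' : ∀ s ∈ X₁'.faces, s.map j' ∈ X₂'.faces) (hY' : ∀ s ∈ Y₁'.faces, s.map j' ∈ Y₂'.faces) :
    relMap ε f hX₁ hY₁ ≫ embeddingMap j' G' hX' hY' =
      embeddingMap j G hX hY ≫ relMap δ f hX₂ hY₂ := by
  refine HomologicalComplex.hom_ext _ _ fun n =>
    AddCommGrpCat.hom_ext (AddMonoidHom.ext fun c => ?_)
  obtain ⟨c, rfl⟩ := QuotientAddGroup.mk_surjective c
  change ((chainExtend j' G' hX' n (chainPush ε f hX₁ n c) : orientedChains X₂' G' n) :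
      relChains X₂' Y₂' G' n) =
    ((chainPush δ f hX₂ n (chainExtend j G hX n c) : orientedChains X₂' G' n) :
      relChains X₂' Y₂' G' n)
  congr 1
  exact Subtype.ext (extendChains_push ε δ j j' h f c.1)

end Naturality

/-! ### The join complex of a relation and its two cone selections. -/

section Dowker

variable {V : Type u} {W : Type w}

/-- The complex with vertex set `V ⊕ W` whose faces are the nonempty sets `s ⊔ t` such that all
elements of `s` are related to all elements of `t`, the elements of `s` have a common related
element of `W`, and the elements of `t` have a common related element of `V`. -/
def dowkerJoin (R : V → W → Prop) : PreAbstractSimplicialComplex (V ⊕ W) where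
  faces := {z | z.Nonempty ∧ (∀ v w, Sum.inl v ∈ z → Sum.inr w ∈ z → R v w) ∧
    (∃ w, ∀ v, Sum.inl v ∈ z → R v w) ∧ ∃ v, ∀ w, Sum.inr w ∈ z → R v w}
  isRelLowerSet_faces := by
    rintro z ⟨hz, h, ⟨w₀, hw⟩, v₀, hv⟩
    refine ⟨hz, fun z' hz' hne => ⟨hne, ?_, ⟨w₀, ?_⟩, v₀, ?_⟩⟩
    · exact fun v w h₁ h₂ => h v w (hz' h₁) (hz' h₂)
    · exact fun v h₁ => hw v (hz' h₁)
    · exact fun w h₁ => hv w (hz' h₁)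

variable {R : V → W → Prop}

theorem map_inl_mem_dowkerJoin {s : Finset V} :
    s.map Function.Embedding.inl ∈ (dowkerJoin R).faces ↔
      s.Nonempty ∧ ∃ w, ∀ v ∈ s, R v w := by
  constructor
  · rintro ⟨h, -, ⟨w, hw⟩, -⟩
    exact ⟨Finset.map_nonempty.mp h, w, fun v hv => hw v (Finset.mem_map.mpr ⟨v, hv, rfl⟩)⟩
  · rintro ⟨h, w, hw⟩
    refine ⟨h.map, fun v w' _ h' => ?_, ⟨w, fun v hv => hw v ?_⟩, h.choose, fun w' h' => ?_⟩
    · simp at h'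
    · simpa using hv
    · simp at h'

theorem map_inr_mem_dowkerJoin {t : Finset W} :
    t.map Function.Embedding.inr ∈ (dowkerJoin R).faces ↔
      t.Nonempty ∧ ∃ v, ∀ w ∈ t, R v w := by
  constructor
  · rintro ⟨h, -, -, v, hv⟩
    exact ⟨Finset.map_nonempty.mp h, v, fun w hw => hv w (Finset.mem_map.mpr ⟨w, hw, rfl⟩)⟩
  · rintro ⟨h, v, hv⟩
    refine ⟨h.map, fun v' w h' _ => ?_, ⟨h.choose, fun v' h' => ?_⟩, v, fun w hw => hv w ?_⟩
    · simp at h'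
    · simp at h'
    · simpa using hw

theorem mapsFaces_dowkerJoin {V' : Type u} {W' : Type w} {R' : V' → W' → Prop} (ε : V ≃ V')
    (δ : W ≃ W') (h : ∀ v w, R v w → R' (ε v) (δ w)) :
    MapsFaces (Equiv.sumCongr ε δ) (dowkerJoin R) (dowkerJoin R') := by
  rintro z ⟨hz, h', ⟨w₀, hw⟩, v₀, hv⟩
  have hl : ∀ v', Sum.inl v' ∈ z.map (Equiv.sumCongr ε δ).toEmbedding →
      ∃ v, Sum.inl v ∈ z ∧ ε v = v' := by
    intro v' h
    obtain ⟨a | a, ha, hav⟩ := Finset.mem_map.mp h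
    · exact ⟨a, ha, Sum.inl_injective hav⟩
    · cases hav
  have hr : ∀ w', Sum.inr w' ∈ z.map (Equiv.sumCongr ε δ).toEmbedding →
      ∃ w, Sum.inr w ∈ z ∧ δ w = w' := by
    intro w' h
    obtain ⟨a | a, ha, haw⟩ := Finset.mem_map.mp h
    · cases haw
    · exact ⟨a, ha, Sum.inr_injective haw⟩
  refine ⟨hz.map, fun v' w' h₁ h₂ => ?_, ⟨δ w₀, fun v' h₁ => ?_⟩, ε v₀, fun w' h₂ => ?_⟩
  · obtain ⟨v, h₁', rfl⟩ := hl v' h₁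
    obtain ⟨w, h₂', rfl⟩ := hr w' h₂
    exact h v w (h' v w h₁' h₂')
  · obtain ⟨v, h₁', rfl⟩ := hl v' h₁
    exact h v w₀ (hw v h₁')
  · obtain ⟨w, h₂', rfl⟩ := hr w' h₂
    exact h v₀ w (hv w h₂')

theorem exists_isConeSelection_inl [Nonempty V] :
    ∃ sel, IsConeSelection (Set.range (Function.Embedding.inl : V ↪ V ⊕ W)) (dowkerJoin R) sel := by
  classical
  -- The choice sees only the `W`-part of `z`, so adding elements of `V` cannot change it; it is
  -- arbitrary when the `W`-part has no common related element.
  refine ⟨fun z => Sum.inl (Classical.epsilon fun v => ∀ w, Sum.inr w ∈ z → R v w),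
    .of_decidableEq (fun z _ => ⟨_, rfl⟩) ?_ ?_⟩
  · rintro z hz ⟨hne, h, -, hv⟩
    have key := Classical.epsilon_spec hv
    -- A `w` already in `z` is related to all `V`-vertices, the new one included, and so witnesses
    -- the third condition.
    obtain ⟨w | w, hwz, hw⟩ := Set.not_subset.mp hz
    · exact absurd ⟨w, rfl⟩ hw
    refine ⟨Finset.insert_nonempty _ _, fun v' w' h₁ h₂ => ?_, ⟨w, fun v' h₁ => ?_⟩, _,
      fun w' h₂ => key w' (by simpa using h₂)⟩
    · rw [Finset.mem_insert] at h₁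
      rcases h₁ with h₁ | h₁
      · rw [Sum.inl_injective h₁]
        exact key w' (by simpa using h₂)
      · exact h v' w' h₁ (by simpa using h₂)
    · rw [Finset.mem_insert] at h₁
      rcases h₁ with h₁ | h₁
      · rw [Sum.inl_injective h₁]
        exact key w hwz
      · exact h v' w h₁ hwz
  · rintro _ ⟨v, rfl⟩ z -
    simp

theorem exists_isConeSelection_inr [Nonempty W] :
    ∃ sel, IsConeSelection (Set.range (Function.Embedding.inr : W ↪ V ⊕ W)) (dowkerJoin R) sel := by
  classical
  refine ⟨fun z => Sum.inr (Classical.epsilon fun w => ∀ v, Sum.inl v ∈ z → R v w),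
    .of_decidableEq (fun z _ => ⟨_, rfl⟩) ?_ ?_⟩
  · rintro z hz ⟨hne, h, hw, -⟩
    have key := Classical.epsilon_spec hw
    obtain ⟨v | v, hvz, hv⟩ := Set.not_subset.mp hz
    swap
    · exact absurd ⟨v, rfl⟩ hv
    refine ⟨Finset.insert_nonempty _ _, fun v' w' h₁ h₂ => ?_,
      ⟨_, fun v' h₁ => key v' (by simpa using h₁)⟩, v, fun w' h₂ => ?_⟩
    · rw [Finset.mem_insert] at h₂
      rcases h₂ with h₂ | h₂
      · rw [Sum.inr_injective h₂]
        exact key v' (by simpa using h₁)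
      · exact h v' w' (by simpa using h₁) h₂
    · rw [Finset.mem_insert] at h₂
      rcases h₂ with h₂ | h₂
      · rw [Sum.inr_injective h₂]
        exact key v hvz
      · exact h v w' hvz h₂
  · rintro _ ⟨w, rfl⟩ z -
    simp

end Dowker

/-! ### Relative Dowker duality. -/

section DowkerQuasiIso

variable {V W : Type u} [Finite V] [Finite W] {R : V → W → Prop} (G : Type v) [AddCommGroup G]

theorem quasiIso_relChainComplex_of_isEmpty {V U : Type u} [Finite V] [Finite U] [IsEmpty V]
    [IsEmpty U] {X Y : PreAbstractSimplicialComplex V} {X' Y' : PreAbstractSimplicialComplex U}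
    (φ : relChainComplex X Y G ⟶ relChainComplex X' Y' G) : QuasiIso φ := by
  have h₁ : ∀ n, Subsingleton (relChains X Y G n) := fun n =>
    QuotientAddGroup.mk_surjective.subsingleton
  have h₂ : ∀ n, Subsingleton (relChains X' Y' G n) := fun n =>
    QuotientAddGroup.mk_surjective.subsingleton
  refine ⟨fun i => ?_⟩
  rw [quasiIsoAt_iff]
  exact quasiIso_of_elements _ (fun x _ _ _ => ⟨0, (h₁ i).elim _ _⟩)
    fun x _ => ⟨0, map_zero _, 0, (h₂ i).elim _ _⟩

theorem map_mem_top_faces {V U : Type u} (j : V ↪ U) :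
    ∀ s ∈ (⊤ : PreAbstractSimplicialComplex V).faces,
      s.map j ∈ (⊤ : PreAbstractSimplicialComplex U).faces :=
  fun s hs => Finset.Nonempty.map (s := s) hs

theorem quasiIso_embeddingMap_inl (hVW : Nonempty W → Nonempty V)
    {Y : PreAbstractSimplicialComplex V}
    (hY : ∀ s, s ∈ Y.faces ↔ s.Nonempty ∧ ∃ w, ∀ v ∈ s, R v w) :
    QuasiIso (embeddingMap Function.Embedding.inl G (map_mem_top_faces _)
      fun s hs => (map_inl_mem_dowkerJoin (R := R)).mpr ((hY s).mp hs)) := by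
  -- With `V` empty there is nothing to select; `hVW` then forces `W` to be empty, and all chain
  -- groups vanish.
  rcases isEmpty_or_nonempty V with hV | hV
  · have : IsEmpty W := not_nonempty_iff.mp fun h => not_nonempty_iff.mpr hV (hVW h)
    exact quasiIso_relChainComplex_of_isEmpty G _
  · obtain ⟨sel, hsel⟩ := exists_isConeSelection_inl (R := R)
    exact quasiIso_embeddingMap _ G hsel _ _
      fun s hs => (hY s).mpr (map_inl_mem_dowkerJoin.mp hs)

theorem quasiIso_embeddingMap_inr (hVW : Nonempty V → Nonempty W)
    {Y : PreAbstractSimplicialComplex W}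
    (hY : ∀ s, s ∈ Y.faces ↔ s.Nonempty ∧ ∃ v, ∀ w ∈ s, R v w) :
    QuasiIso (embeddingMap Function.Embedding.inr G (map_mem_top_faces _)
      fun s hs => (map_inr_mem_dowkerJoin (R := R)).mpr ((hY s).mp hs)) := by
  rcases isEmpty_or_nonempty W with hW | hW
  · have : IsEmpty V := not_nonempty_iff.mp fun h => not_nonempty_iff.mpr hW (hVW h)
    exact quasiIso_relChainComplex_of_isEmpty G _
  · obtain ⟨sel, hsel⟩ := exists_isConeSelection_inr (R := R)
    exact quasiIso_embeddingMap _ G hsel _ _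
      fun s hs => (hY s).mpr (map_inr_mem_dowkerJoin.mp hs)

end DowkerQuasiIso

/-! ### The relation between edges and two-part partitions. -/

section EdgesAndPartitions

variable {A B : Type u}

/-- The two ends of an edge lie in the same part of a partition. -/
def LiesInPart (e : TwoSubset A) (r : TwoPartition A) : Prop :=
  ∀ a ∈ e.1, ∀ b ∈ e.1, r.1 a b

theorem LiesInPart.map (f : A ≃ B) (e : TwoSubset A) (r : TwoPartition A) (h : LiesInPart e r) :
    LiesInPart (twoSubsetCongr f e) (twoPartitionCongr f r) := by
  intro a ha b hb
  obtain ⟨a, ha', rfl⟩ := Sym2.mem_map.mp ha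
  obtain ⟨b, hb', rfl⟩ := Sym2.mem_map.mp hb
  change r.1 (f.symm (f a)) (f.symm (f b))
  simpa using h a ha' b hb'

/-- The partition into a set and its complement. -/
theorem exists_twoPartition (s : Set A) {a b : A} (ha : a ∈ s) (hb : b ∉ s) :
    ∃ r : TwoPartition A, ∀ x y, r.1 x y ↔ (x ∈ s ↔ y ∈ s) := by
  -- Membership in `s` maps onto `Prop`, which has two elements, so its kernel has two classes.
  have hsurj : Function.Surjective fun x => x ∈ s := fun p => by
    by_cases hp : p
    · exact ⟨a, by simp [ha, hp]⟩
    · exact ⟨b, by simp [hb, hp]⟩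
  refine ⟨⟨Setoid.ker fun x => x ∈ s, ?_⟩, fun x y => ?_⟩
  · rw [Nat.card_congr (Setoid.quotientKerEquivOfSurjective _ hsurj)]
    simp
  · rw [Setoid.ker_def, eq_iff_iff]

theorem TwoPartition.exists_not_rel (r : TwoPartition A) : ∃ a b, ¬ r.1 a b := by
  obtain ⟨x, y, hxy, -⟩ := Nat.card_eq_two_iff.mp r.2
  obtain ⟨a, rfl⟩ := Quotient.exists_rep x
  obtain ⟨b, rfl⟩ := Quotient.exists_rep y
  exact ⟨a, b, fun h => hxy (Quotient.sound h)⟩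

theorem nonempty_twoSubset_iff_nonempty_twoPartition :
    Nonempty (TwoSubset A) ↔ Nonempty (TwoPartition A) := by
  constructor
  · rintro ⟨⟨e, he⟩⟩
    induction e with | _ a b =>
    obtain ⟨r, -⟩ := exists_twoPartition {a} (Set.mem_singleton a)
      (show b ∉ ({a} : Set A) from fun h => he (Sym2.mk_isDiag_iff.mpr h.symm))
    exact ⟨r⟩
  · rintro ⟨r⟩
    obtain ⟨a, b, h⟩ := r.exists_not_rel
    refine ⟨⟨s(a, b), fun hab => h ?_⟩⟩
    rw [Sym2.mk_isDiag_iff.mp hab]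

/-- A disconnected graph respects the partition into one component and its complement; conversely, a
path along edges respecting a partition never leaves its part. -/
theorem mem_nonconnectedGraphs_iff (s : Finset (TwoSubset A)) :
    s ∈ (nonconnectedGraphs A).faces ↔ s.Nonempty ∧ ∃ r, ∀ e ∈ s, LiesInPart e r := by
  refine and_congr_right fun _ => ⟨fun h => ?_, ?_⟩
  · simp only [SimpleGraph.Preconnected, not_forall] at h
    obtain ⟨a, b, hab⟩ := h
    obtain ⟨r, hr⟩ := exists_twoPartition {x | (faceGraph s).Reachable a x}
      (SimpleGraph.Reachable.refl a) hab
    refine ⟨r, fun e he x hx y hy => (hr x y).mpr ?_⟩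
    rcases eq_or_ne x y with rfl | hxy
    · rfl
    · have hadj : (faceGraph s).Adj x y := by
        refine (SimpleGraph.fromEdgeSet_adj _).mpr ⟨⟨e, he, ?_⟩, hxy⟩
        exact (Sym2.mem_and_mem_iff hxy).mp ⟨hx, hy⟩
      exact ⟨fun h => h.trans hadj.reachable, fun h => h.trans hadj.symm.reachable⟩
  · rintro ⟨r, hr⟩ hc
    obtain ⟨a, b, hab⟩ := r.exists_not_rel
    have h := (SimpleGraph.reachable_iff_reflTransGen a b).mp (hc a b)
    apply hab
    clear hab
    induction h with
    | refl => exact r.1.refl a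
    | tail _ hadj ih =>
      obtain ⟨⟨e, he, hxy⟩, -⟩ := hadj
      refine r.1.trans ih (hr e he _ ?_ _ ?_)
      · rw [hxy]
        exact Sym2.mem_mk_left _ _
      · rw [hxy]
        exact Sym2.mem_mk_right _ _

theorem mem_noncompletePartitions_iff (s : Finset (TwoPartition A)) :
    s ∈ (noncompletePartitions A).faces ↔ s.Nonempty ∧ ∃ e, ∀ r ∈ s, LiesInPart e r := by
  refine and_congr_right fun _ => ⟨?_, ?_⟩
  · rintro ⟨a, b, hab, h⟩
    refine ⟨⟨s(a, b), fun h' => hab (Sym2.mk_isDiag_iff.mp h')⟩, fun r hr x hx y hy => ?_⟩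
    rcases Sym2.mem_iff.mp hx with rfl | rfl <;> rcases Sym2.mem_iff.mp hy with rfl | rfl
    · exact r.1.refl _
    · exact h r hr
    · exact r.1.symm (h r hr)
    · exact r.1.refl _
  · rintro ⟨⟨e, he⟩, h⟩
    induction e with | _ a b =>
    exact ⟨a, b, fun h' => he (Sym2.mk_isDiag_iff.mpr h'),
      fun r hr => h r hr a (Sym2.mem_mk_left a b) b (Sym2.mem_mk_right a b)⟩

end EdgesAndPartitions

/-! ### The natural zigzag of quasi-isomorphisms. -/

section Comparison

/-- The simplex spanned by all edges and all partitions into two parts, modulo the join complex of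
the relation `LiesInPart`. -/
noncomputable def edgePartitionComplex :
    Core FintypeCat.{u} × AddCommGrpCat.{v} ⥤ ChainComplex AddCommGrpCat.{max u v} ℕ where
  obj P := relChainComplex (⊤ : PreAbstractSimplicialComplex (TwoSubset P.1.of ⊕ TwoPartition P.1.of))
    (dowkerJoin LiesInPart) P.2
  map f := relMap (Equiv.sumCongr (twoSubsetCongr (FintypeCat.equivEquivIso.symm f.1.iso))
      (twoPartitionCongr (FintypeCat.equivEquivIso.symm f.1.iso))) f.2.hom
    (map_mem_top_faces _) (mapsFaces_dowkerJoin _ _ (LiesInPart.map _))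
  map_id _ := by
    refine relMap_eq_id _ _ _ _ (fun x => ?_) (fun _ => rfl)
    obtain ⟨x, hx⟩ | x := x
    · induction x with | _ a b => rfl
    · rfl
  map_comp _ _ := by
    refine relMap_comp _ _ _ _ _ _ _ _ _ _ _ _ (fun x => ?_) (fun _ => rfl)
    obtain ⟨x, hx⟩ | x := x
    · induction x with | _ a b => rfl
    · rfl

/-- The inclusion of the edges. -/
noncomputable def connectedGraphComplexInclusion :
    connectedGraphComplex.{u, v} ⟶ edgePartitionComplex.{u, v} where
  app P := embeddingMap Function.Embedding.inl P.2 (map_mem_top_faces _)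
    fun s hs => map_inl_mem_dowkerJoin.mpr ((mem_nonconnectedGraphs_iff s).mp hs)
  naturality _ _ _ := relMap_comp_embeddingMap _ _ _ _ (fun _ => rfl) _ _ _ _ _ _ _ _ _

/-- The inclusion of the partitions. -/
noncomputable def completePartitionComplexInclusion :
    completePartitionComplex.{u, v} ⟶ edgePartitionComplex.{u, v} where
  app P := embeddingMap Function.Embedding.inr P.2 (map_mem_top_faces _)
    fun s hs => map_inr_mem_dowkerJoin.mpr ((mem_noncompletePartitions_iff s).mp hs)
  naturality _ _ _ := relMap_comp_embeddingMap _ _ _ _ (fun _ => rfl) _ _ _ _ _ _ _ _ _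

instance (P : Core FintypeCat.{u} × AddCommGrpCat.{v}) :
    QuasiIso (connectedGraphComplexInclusion.app P) :=
  quasiIso_embeddingMap_inl _ nonempty_twoSubset_iff_nonempty_twoPartition.mpr
    mem_nonconnectedGraphs_iff

instance (P : Core FintypeCat.{u} × AddCommGrpCat.{v}) :
    QuasiIso (completePartitionComplexInclusion.app P) :=
  quasiIso_embeddingMap_inr _ nonempty_twoSubset_iff_nonempty_twoPartition.mp
    mem_noncompletePartitions_iff

theorem isIso_whiskerRight_homologyFunctor {C : Type*} [Category C]
    {F F' : C ⥤ ChainComplex AddCommGrpCat.{u} ℕ} (φ : F ⟶ F') [∀ P, QuasiIso (φ.app P)] (i : ℕ) :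
    IsIso (Functor.whiskerRight φ (HomologicalComplex.homologyFunctor _ _ i)) := by
  rw [NatTrans.isIso_iff_isIso_app]
  intro P
  change IsIso (HomologicalComplex.homologyMap (φ.app P) i)
  infer_instance

end Comparison

end Vassiliev

theorem theorem3 (i : ℕ) :
    Nonempty
      (Vassiliev.completePartitionComplex.{u, v} ⋙
          HomologicalComplex.homologyFunctor AddCommGrpCat.{max u v} (ComplexShape.down ℕ) i ≅
        Vassiliev.connectedGraphComplex.{u, v} ⋙
          HomologicalComplex.homologyFunctor AddCommGrpCat.{max u v} (ComplexShape.down ℕ) i) := by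
  have := Vassiliev.isIso_whiskerRight_homologyFunctor
    Vassiliev.connectedGraphComplexInclusion.{u, v} i
  have := Vassiliev.isIso_whiskerRight_homologyFunctor
    Vassiliev.completePartitionComplexInclusion.{u, v} i
  exact ⟨asIso (Functor.whiskerRight Vassiliev.completePartitionComplexInclusion.{u, v} _) ≪≫
    (asIso (Functor.whiskerRight Vassiliev.connectedGraphComplexInclusion.{u, v} _)).symm⟩
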